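/- For a quantization scheme on $\mathbb R^n$ let $N(\mathcal U,\epsilon)$ be the minimal number $l$ of codewords $v_1,\dots,v_l\in\mathbb R^n$ such that every vector of $\mathcal U$ is represented with Euclidean error smaller than $\epsilon$, where $\mathcal U=\{x\in\mathbb R^n:\|x\|_2\le 1\}$. In the cluster-based scheme a vector is represented by a single codeword (the nearest one). In sparse regression with at most $t$ nonzero coefficients a vector is represented by a combination $\sum_{j} f_j v_j$, where the coefficient vector $f\in\mathbb R^l$ is $t$-sparse (at most $t$ nonzero entries) and $\|f\|_2\le 1$. (i) For the cluster-based scheme, $N(\mathcal U,\epsilon)\ge 1/\epsilon^n$ for all $n\ge 1$ and $\epsilon>0$. (ii) There is an absolute constant $D>0$ such that for all integers $1\le t\le l$ and all $0<\epsilon\le 1$ the $t$-sparse vectors in the unit ball of $\mathbb R^l$ have $\epsilon$-covering number at most $\left(\frac{Dl}{t\epsilon}\right)^t$, and such that, with $K=eD$, the following holds. Let $n\ge 1$, $0<\epsilon\le 1$, $0<\eta<1$, let $q$ be a real number with \[ q\ \ge\ \max\left(3,\ \frac{\log(4/\epsilon)}{\log\log(2n/\eta)}\right) \] (the quotient is omitted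 if its denominator vanishes, which is possible only for $n=1$), and let $t$ be an integer with \[ t\ \ge\ \frac{4n}{\epsilon\left(\log K+q\log(4n)-(q+1)\log\epsilon\right)} . \] Then for sparse regression with at most $t$ nonzero coefficients, $N(\mathcal U,\epsilon)\le (4n/\epsilon)^q$. -/

import Mathlib

open scoped ENNReal NNReal

/-- A codebook of `l` codewords in `ℝⁿ` (with the Euclidean norm). -/
abbrev Codebook (n l : ℕ) : Type := Fin l → EuclideanSpace ℝ (Fin n)

/-- A quantization scheme on `ℝⁿ`: it assigns to every codebook the set of the vectors that can
be produced from its codewords. -/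
abbrev QuantScheme (n : ℕ) : Type := ∀ l : ℕ, Codebook n l → Set (EuclideanSpace ℝ (Fin n))

/-- The codebook `V` represents every vector of `U` with an error smaller than `ε`. -/
def Represents {n : ℕ} (S : QuantScheme n) (U : Set (EuclideanSpace ℝ (Fin n))) (ε : ℝ)
    {l : ℕ} (V : Codebook n l) : Prop :=
  ∀ x ∈ U, ∃ y ∈ S l V, ‖x - y‖ < ε

/-- `N(U, ε)` for a scheme `S`: the minimal number of codewords of a codebook that represents
every vector of `U` with an error smaller than `ε` (`⊤` if no finite codebook does). -/
noncomputable def minCodewords {n : ℕ} (S : QuantScheme n)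
    (U : Set (EuclideanSpace ℝ (Fin n))) (ε : ℝ) : ℕ∞ :=
  ⨅ (l : ℕ) (V : Codebook n l) (_ : Represents S U ε V), (l : ℕ∞)

/-- Cluster-based quantization: a vector is replaced by a single (its nearest) codeword. -/
def clusterScheme (n : ℕ) : QuantScheme n := fun _ V => Set.range V

/-- The `t`-sparse vectors of `ℝˡ` in the unit ball: at most `t` nonzero entries and Euclidean
norm at most one. -/
def sparseVectors (l t : ℕ) : Set (EuclideanSpace ℝ (Fin l)) :=
  {f | {j | f j ≠ 0}.ncard ≤ t ∧ ‖f‖ ≤ 1}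

/-- Sparse regression with at most `t` nonzero coefficients: a vector is replaced by a
combination `V f = ∑ j, f j • V j` of the codewords with a `t`-sparse coefficient vector `f`. -/
def sparseScheme (n t : ℕ) : QuantScheme n :=
  fun l V => {y | ∃ f ∈ sparseVectors l t, y = ∑ j, f j • V j}

/-- `D` is an admissible constant in the covering bound `(D l / (t ε))ᵗ` for the `t`-sparse
vectors in the unit ball of `ℝˡ`. -/
def IsSparseCoveringConstant (D : ℝ) : Prop :=
  ∀ (l t : ℕ) (ε : ℝ≥0), 1 ≤ t → t ≤ l → 0 < ε → ε ≤ 1 →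
    ((Metric.coveringNumber ε (sparseVectors l t) : ℕ∞) : ℝ≥0∞)
      ≤ ENNReal.ofReal ((D * l / (t * ε)) ^ t)

/-! For clustering, the balls of radius `ε` around the codewords cover the unit ball, so their
volumes add up to at least its volume. For sparse regression, the `n` coordinates are cut into
blocks of length at most `⌈n / t⌉`, and the codebook is the union of nets of the unit balls of the
blocks. A vector picks one codeword per block, with the norm of its block part as coefficient; by
Pythagoras the coefficients have norm at most one and the relative block errors combine without loss
(`minCodewords_sparseScheme_le_of_blocks`). This takes at most `t * (4 / ε) ^ ⌈n / t⌉` codewords,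
and the lower bound on `t` makes this at most `(4 * n / ε) ^ q` (`mul_pow_ceil_le_rpow`). The sparse
covering bound, with `D = 3e`, enters this estimate only through the value `K = 3e²`. -/

/-! ### Nets of unit balls by volume comparison. -/

open Metric MeasureTheory in
/-- An `ε`-separated finite subset of the unit ball of a `d`-dimensional space has at most
`(1 + 2 / ε) ^ d` elements. -/
theorem card_le_of_separated_closedBall {E : Type*} [NormedAddCommGroup E] [NormedSpace ℝ E]
    [FiniteDimensional ℝ E] (s : Finset E) {ε : ℝ} (hε : 0 < ε) (hs : ∀ c ∈ s, ‖c‖ ≤ 1)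
    (hsep : ∀ c ∈ s, ∀ d ∈ s, c ≠ d → ε ≤ ‖c - d‖) :
    (s.card : ℝ) ≤ (1 + 2 / ε) ^ Module.finrank ℝ E := by
  borelize E
  let μ : Measure E := Measure.addHaar
  set d := Module.finrank ℝ E
  have hdisj : Set.PairwiseDisjoint (s : Set E) (fun c => ball c (ε / 2)) := by
    intro c hc d hd hcd
    apply ball_disjoint_ball
    rw [dist_eq_norm]
    convert hsep c hc d hd hcd using 1
    ring
  have hsub : (⋃ c ∈ s, ball c (ε / 2)) ⊆ ball (0 : E) (1 + ε / 2) := by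
    refine Set.iUnion₂_subset fun c hc => ball_subset_ball' ?_
    rw [dist_zero_right]
    linarith [hs c hc]
  have hμ : (s.card : ℝ≥0∞) * (ENNReal.ofReal ((ε / 2) ^ d) * μ (ball 0 1)) ≤
      ENNReal.ofReal ((1 + ε / 2) ^ d) * μ (ball 0 1) := by
    rw [← μ.addHaar_ball_of_pos (0 : E) (by positivity : (0 : ℝ) < 1 + ε / 2)]
    refine le_trans (le_of_eq ?_) (measure_mono hsub)
    rw [measure_biUnion_finset hdisj fun _ _ => measurableSet_ball,
      Finset.sum_congr rfl fun c _ => μ.addHaar_ball_of_pos c (half_pos hε)]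
    simp [d]
  have h0 : μ (ball 0 1) ≠ 0 := (measure_ball_pos _ _ one_pos).ne'
  rw [← mul_assoc, ENNReal.mul_le_mul_iff_left h0 measure_ball_lt_top.ne,
    ← ENNReal.ofReal_natCast, ← ENNReal.ofReal_mul (by positivity),
    ENNReal.ofReal_le_ofReal_iff (by positivity), ← le_div_iff₀ (by positivity),
    ← div_pow] at hμ
  refine hμ.trans_eq ?_
  congr 1
  field_simp
  ring

open Metric in
/-- The unit ball of a `d`-dimensional space has an `ε`-net with at most `(1 + 2 / ε) ^ d`
points. -/
theorem exists_net_closedBall (E : Type*) [NormedAddCommGroup E] [NormedSpace ℝ E]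
    [FiniteDimensional ℝ E] {ε : ℝ} (hε : 0 < ε) :
    ∃ s : Finset E, (∀ c ∈ s, ‖c‖ ≤ 1) ∧ (s.card : ℝ) ≤ (1 + 2 / ε) ^ Module.finrank ℝ E ∧
      ∀ x : E, ‖x‖ ≤ 1 → ∃ c ∈ s, ‖x - c‖ ≤ ε := by
  classical
  lift ε to ℝ≥0 using hε.le
  let A : Set E := closedBall 0 1
  -- A maximal separated set is a net only if the packing number is finite. An infinite separated
  -- set would contain a finite one exceeding the volume bound.
  have hfin : packingNumber ε A ≠ ⊤ := by
    refine ne_top_of_le_ne_top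
      (ENat.natCast_ne_top ⌊(1 + 2 / (ε : ℝ)) ^ Module.finrank ℝ E⌋₊) ?_
    refine iSup_le fun C => iSup_le fun hCA => iSup_le fun hC => ?_
    have key : ∀ s : Finset E, (s : Set E) ⊆ C →
        s.card ≤ ⌊(1 + 2 / (ε : ℝ)) ^ Module.finrank ℝ E⌋₊ := by
      intro s hs
      refine Nat.le_floor (card_le_of_separated_closedBall s hε
        (fun c hc => by simpa [A] using hCA (hs hc)) fun c hc d hd hcd => ?_)
      have : (ε : ℝ≥0∞) < edist c d := hC (hs hc) (hs hd) hcd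
      rw [edist_nndist, ENNReal.coe_lt_coe] at this
      rw [← dist_eq_norm]
      exact_mod_cast this.le
    by_cases hCf : C.Finite
    · rw [hCf.encard_eq_coe_toFinset_card]
      exact_mod_cast key _ (by simp)
    · obtain ⟨s, hs, hcard⟩ := (Set.Infinite.exists_subset_card_eq hCf
        (⌊(1 + 2 / (ε : ℝ)) ^ Module.finrank ℝ E⌋₊ + 1))
      have := key s hs
      omega
  obtain ⟨hsub, hsep, hcov⟩ := And.intro (maximalSeparatedSet_subset (ε := ε) (A := A))
    (And.intro (isSeparated_maximalSeparatedSet (ε := ε) (A := A))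
      (isCover_maximalSeparatedSet hfin))
  have hf : (maximalSeparatedSet ε A).Finite := by
    rw [← Set.encard_ne_top_iff, encard_maximalSeparatedSet hfin]
    exact hfin
  have hnorm : ∀ c ∈ hf.toFinset, ‖c‖ ≤ 1 := fun c hc => by
    simpa [A] using hsub (hf.mem_toFinset.1 hc)
  refine ⟨hf.toFinset, hnorm, card_le_of_separated_closedBall _ hε hnorm
    fun c hc d hd hcd => ?_, fun x hx => ?_⟩
  · have : (ε : ℝ≥0∞) < edist c d :=
      hsep (hf.mem_toFinset.1 hc) (hf.mem_toFinset.1 hd) hcd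
    rw [edist_nndist, ENNReal.coe_lt_coe] at this
    rw [← dist_eq_norm]
    exact_mod_cast this.le
  · obtain ⟨c, hc, hxc⟩ := hcov (show x ∈ A by simpa [A] using hx)
    refine ⟨c, hf.mem_toFinset.2 hc, ?_⟩
    have hxc' : edist x c ≤ ε := hxc
    rw [edist_nndist, ENNReal.coe_le_coe] at hxc'
    rw [← dist_eq_norm]
    exact_mod_cast hxc'

/-! ### Covering the sparse vectors. -/

/-- The vectors of `ℝˡ` supported in `S`. -/
def supportedVectors {l : ℕ} (S : Finset (Fin l)) : Submodule ℝ (EuclideanSpace ℝ (Fin l)) where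
  carrier := {f | ∀ j ∉ S, f j = 0}
  add_mem' hf hg j hj := by simp [hf j hj, hg j hj]
  zero_mem' j _ := by simp
  smul_mem' a f hf j hj := by simp [hf j hj]

theorem finrank_supportedVectors_le {l : ℕ} (S : Finset (Fin l)) :
    Module.finrank ℝ (supportedVectors S) ≤ S.card := by
  let φ : supportedVectors S →ₗ[ℝ] (S → ℝ) :=
    { toFun := fun f j => f.1 j
      map_add' := fun f g => by ext; simp
      map_smul' := fun a f => by ext; simp }
  have hφ : Function.Injective φ := by
    intro f g h
    ext j
    by_cases hj : j ∈ S
    · exact congrFun h ⟨j, hj⟩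
    · rw [f.2 j hj, g.2 j hj]
  simpa using LinearMap.finrank_le_finrank_of_injective hφ

theorem exists_net_supportedVectors {l : ℕ} (S : Finset (Fin l)) {ε : ℝ} (hε : 0 < ε) :
    ∃ s : Finset (EuclideanSpace ℝ (Fin l)),
      (∀ c ∈ s, c ∈ supportedVectors S ∧ ‖c‖ ≤ 1) ∧ (s.card : ℝ) ≤ (1 + 2 / ε) ^ S.card ∧
      ∀ x ∈ supportedVectors S, ‖x‖ ≤ 1 → ∃ c ∈ s, ‖x - c‖ ≤ ε := by
  classical
  obtain ⟨s, h1, h2, h3⟩ := exists_net_closedBall (supportedVectors S) hε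
  refine ⟨s.image Subtype.val, fun c hc => ?_, ?_, fun x hx hx1 => ?_⟩
  · obtain ⟨d, hd, rfl⟩ := Finset.mem_image.1 hc
    exact ⟨d.2, h1 d hd⟩
  · calc ((s.image Subtype.val).card : ℝ) ≤ s.card := by exact_mod_cast Finset.card_image_le
      _ ≤ (1 + 2 / ε) ^ Module.finrank ℝ (supportedVectors S) := h2
      _ ≤ (1 + 2 / ε) ^ S.card :=
        pow_le_pow_right₀ (by linarith [div_pos two_pos hε]) (finrank_supportedVectors_le S)
  · obtain ⟨c, hc, hxc⟩ := h3 ⟨x, hx⟩ hx1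
    exact ⟨c, Finset.mem_image_of_mem _ hc, hxc⟩

/-- The term `t ^ t / t!` of the exponential series at `t` is at most `e ^ t`. -/
theorem choose_le_exp_mul_div_pow (l : ℕ) {t : ℕ} (ht : 1 ≤ t) :
    (l.choose t : ℝ) ≤ (Real.exp 1 * l / t) ^ t := by
  have h1 : (l.choose t : ℝ) ≤ (l : ℝ) ^ t / t.factorial := Nat.choose_le_pow_div t l
  have h2 := Real.pow_div_factorial_le_exp (x := t) (by positivity) t
  have ht' : (0 : ℝ) < t := by exact_mod_cast ht
  refine h1.trans ?_
  rw [div_pow, mul_pow, ← Real.exp_nat_mul, mul_one, div_le_div_iff₀ (by positivity)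
    (by positivity)]
  rw [div_le_iff₀ (by positivity)] at h2
  nlinarith [pow_nonneg (Nat.cast_nonneg (α := ℝ) l) t]

/-- Take the union of nets over all supports of size `t`: the factor `e` comes from the number of
supports, the factor `3` from `1 + 2 / ε ≤ 3 / ε`. -/
theorem isSparseCoveringConstant_three_mul_exp : IsSparseCoveringConstant (3 * Real.exp 1) := by
  classical
  intro l t ε ht htl hε hε1
  have hε0 : (0 : ℝ) < ε := by exact_mod_cast hε
  have hε1' : (ε : ℝ) ≤ 1 := by exact_mod_cast hε1
  choose s hs hcard hnet using
    fun S : Finset (Fin l) => exists_net_supportedVectors S hε0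
  let P : Finset (Finset (Fin l)) := Finset.powersetCard t Finset.univ
  let C : Finset (EuclideanSpace ℝ (Fin l)) := P.biUnion s
  have hsub : (C : Set (EuclideanSpace ℝ (Fin l))) ⊆ sparseVectors l t := by
    intro c hc
    obtain ⟨S, hS, hcS⟩ := Finset.mem_biUnion.1 (Finset.mem_coe.1 hc)
    refine ⟨?_, (hs S c hcS).2⟩
    rw [← (Finset.mem_powersetCard.1 hS).2, ← Set.ncard_coe_finset]
    refine Set.ncard_le_ncard (fun j hj => ?_) S.finite_toSet
    by_contra hjS
    exact hj ((hs S c hcS).1 j hjS)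
  have hcov : Metric.IsCover ε (sparseVectors l t) (C : Set (EuclideanSpace ℝ (Fin l))) := by
    intro x hx
    have hcx : (Finset.univ.filter fun j => x j ≠ 0).card ≤ t := by
      rw [← Set.ncard_coe_finset]
      simpa using hx.1
    obtain ⟨S, hS, hSt⟩ := Finset.exists_superset_card_eq hcx (by simpa using htl)
    obtain ⟨c, hc, hxc⟩ := hnet S x (fun j hj => by
      by_contra h
      exact hj (hS (by simpa using h))) hx.2
    refine ⟨c, Finset.mem_coe.2 (Finset.mem_biUnion.2
      ⟨S, Finset.mem_powersetCard.2 ⟨Finset.subset_univ _, hSt⟩, hc⟩), ?_⟩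
    change edist x c ≤ ε
    rw [edist_nndist, ENNReal.coe_le_coe]
    rw [← dist_eq_norm] at hxc
    exact_mod_cast hxc
  have hC : (C.card : ℝ) ≤ (3 * Real.exp 1 * l / (t * ε)) ^ t := by
    have h1 : (C.card : ℝ) ≤ ∑ S ∈ P, ((s S).card : ℝ) := by
      exact_mod_cast Finset.card_biUnion_le
    have h2 : ∀ S ∈ P, ((s S).card : ℝ) ≤ (3 / (ε : ℝ)) ^ t := fun S hS => by
      have h := hcard S
      rw [(Finset.mem_powersetCard.1 hS).2] at h
      refine h.trans (pow_le_pow_left₀ (by positivity) ?_ t)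
      rw [le_div_iff₀ hε0, add_mul, div_mul_cancel₀ _ hε0.ne']
      linarith
    refine (h1.trans (Finset.sum_le_card_nsmul P _ _ h2)).trans ?_
    have h3 := choose_le_exp_mul_div_pow l ht
    simp only [P, Finset.card_powersetCard, Finset.card_univ, Fintype.card_fin, nsmul_eq_mul]
    calc (l.choose t : ℝ) * (3 / (ε : ℝ)) ^ t
        ≤ (Real.exp 1 * l / t) ^ t * (3 / (ε : ℝ)) ^ t := by gcongr
      _ = _ := by
        rw [← mul_pow]
        congr 1
        field_simp
  have h := hcov.coveringNumber_le_encard hsub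
  rw [Set.encard_coe_eq_coe_finsetCard] at h
  calc ((Metric.coveringNumber ε (sparseVectors l t) : ℕ∞) : ℝ≥0∞)
      ≤ ((C.card : ℕ∞) : ℝ≥0∞) := ENat.toENNReal_mono h
    _ = ENNReal.ofReal C.card := by simp
    _ ≤ _ := ENNReal.ofReal_le_ofReal hC

/-! ### Codeword counts and the lower bound for clustering. -/

theorem minCodewords_le_card {n : ℕ} (S : QuantScheme n) (U : Set (EuclideanSpace ℝ (Fin n)))
    (ε : ℝ) {l : ℕ} (V : Codebook n l) (hV : Represents S U ε V) : minCodewords S U ε ≤ l :=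
  iInf_le_of_le l (iInf_le_of_le V (iInf_le _ hV))

open Metric MeasureTheory in
theorem one_div_pow_le_of_represents_clusterScheme {n l : ℕ} {ε : ℝ} (hε : 0 < ε)
    (V : Codebook n l) (hV : Represents (clusterScheme n) (closedBall 0 1) ε V) :
    1 / ε ^ n ≤ (l : ℝ) := by
  let μ : Measure (EuclideanSpace ℝ (Fin n)) := volume
  have hsub : ball (0 : EuclideanSpace ℝ (Fin n)) 1 ⊆ ⋃ j : Fin l, ball (V j) ε := by
    intro x hx
    obtain ⟨_, ⟨j, rfl⟩, hj⟩ := hV x (ball_subset_closedBall hx)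
    exact Set.mem_iUnion.2 ⟨j, by rwa [mem_ball, dist_eq_norm]⟩
  have hμ : μ (ball 0 1) ≤ ENNReal.ofReal (l * ε ^ n) * μ (ball 0 1) := by
    refine (measure_mono hsub).trans ((measure_iUnion_le _).trans ?_)
    rw [tsum_fintype, Finset.sum_congr rfl fun j _ => μ.addHaar_ball_of_pos (V j) hε,
      ENNReal.ofReal_mul (by positivity)]
    simp [mul_assoc]
  have h0 : μ (ball 0 1) ≠ 0 := (measure_ball_pos _ _ one_pos).ne'
  nth_rewrite 1 [← one_mul (μ (ball 0 1))] at hμ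
  rw [ENNReal.mul_le_mul_iff_left h0 measure_ball_lt_top.ne, ← ENNReal.ofReal_one,
    ENNReal.ofReal_le_ofReal_iff (by positivity)] at hμ
  rwa [div_le_iff₀ (by positivity)]

theorem le_minCodewords_clusterScheme (n : ℕ) {ε : ℝ} (hε : 0 < ε) :
    ENNReal.ofReal (1 / ε ^ n) ≤
      ((minCodewords (clusterScheme n) (Metric.closedBall 0 1) ε : ℕ∞) : ℝ≥0∞) := by
  -- The infimum lives in `ℕ∞`, so the real bound is passed to it through its ceiling.
  have h : ((⌈1 / ε ^ n⌉₊ : ℕ) : ℕ∞) ≤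
      minCodewords (clusterScheme n) (Metric.closedBall 0 1) ε :=
    le_iInf fun l => le_iInf fun V => le_iInf fun hV => by
      exact_mod_cast Nat.ceil_le.2 (one_div_pow_le_of_represents_clusterScheme hε V hV)
  calc ENNReal.ofReal (1 / ε ^ n) ≤ ENNReal.ofReal (⌈1 / ε ^ n⌉₊ : ℕ) :=
        ENNReal.ofReal_le_ofReal (Nat.le_ceil _)
    _ = (((⌈1 / ε ^ n⌉₊ : ℕ) : ℕ∞) : ℝ≥0∞) := by simp
    _ ≤ _ := ENat.toENNReal_mono h

/-! ### The block codebook for sparse regression. -/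

/-- A codebook for sparse regression may be indexed by any finite type. -/
theorem minCodewords_sparseScheme_le_card {n t : ℕ} {U : Set (EuclideanSpace ℝ (Fin n))} {ε : ℝ}
    {ι : Type*} [Fintype ι] (V : ι → EuclideanSpace ℝ (Fin n))
    (hV : ∀ x ∈ U, ∃ f : ι → ℝ, {j | f j ≠ 0}.ncard ≤ t ∧ ∑ j, f j ^ 2 ≤ 1 ∧
      ‖x - ∑ j, f j • V j‖ < ε) :
    minCodewords (sparseScheme n t) U ε ≤ Fintype.card ι := by
  let e := Fintype.equivFin ι
  refine minCodewords_le_card _ _ _ (V ∘ e.symm) fun x hx => ?_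
  obtain ⟨f, h1, h2, h3⟩ := hV x hx
  refine ⟨∑ j, f j • V j, ⟨WithLp.toLp 2 (f ∘ e.symm), ⟨?_, ?_⟩, ?_⟩, h3⟩
  · refine le_trans (le_of_eq ?_) h1
    exact Set.ncard_preimage_of_injective_subset_range (s := {j | f j ≠ 0}) e.symm.injective
      (by simp)
  · rw [EuclideanSpace.norm_eq, Real.sqrt_le_one]
    simpa [e.symm.sum_comp fun j => f j ^ 2] using h2
  · exact (e.symm.sum_comp fun j => f j • V j).symm

/-- The part of a vector on the block `b` of a partition of the coordinates. -/
noncomputable def blockPart {n s : ℕ} (p : Fin n → Fin s) (b : Fin s)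
    (x : EuclideanSpace ℝ (Fin n)) : EuclideanSpace ℝ (Fin n) :=
  WithLp.toLp 2 fun i => if p i = b then x i else 0

/-- Pythagoras for the blocks; it bounds both the norm of the coefficient vector and the total
error. -/
theorem sum_norm_blockPart_sq {n s : ℕ} (p : Fin n → Fin s) (x : EuclideanSpace ℝ (Fin n)) :
    ∑ b, ‖blockPart p b x‖ ^ 2 = ‖x‖ ^ 2 := by
  simp only [EuclideanSpace.norm_sq_eq, blockPart]
  rw [Finset.sum_comm]
  refine Finset.sum_congr rfl fun i _ => ?_
  rw [Finset.sum_eq_single (p i)] <;> simp +contextual [eq_comm]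

theorem minCodewords_sparseScheme_le_of_blocks {n s t m : ℕ} (hst : s ≤ t) {ε : ℝ} (hε : 0 < ε)
    (hε1 : ε ≤ 1) (p : Fin n → Fin s)
    (hp : ∀ b, (Finset.univ.filter fun i => p i = b).card ≤ m) :
    ((minCodewords (sparseScheme n t) (Metric.closedBall 0 1) ε : ℕ∞) : ℝ≥0∞) ≤
      ENNReal.ofReal (s * (4 / ε) ^ m) := by
  classical
  -- A radius below `ε` makes the final error strict; `2 * ε / 3` turns the net bound into `1 + 3 /
  -- ε ≤ 4 / ε`.
  have hε3 : 0 < 2 * ε / 3 := by positivity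
  choose C hC hcard hnet using fun b : Fin s =>
    exists_net_supportedVectors (Finset.univ.filter fun i => p i = b) hε3
  have hrep := minCodewords_sparseScheme_le_card (t := t) (U := Metric.closedBall 0 1) (ε := ε)
    (ι := Σ b, C b) (fun j => j.2.1) (fun x hx => by
      have hx1 : ‖x‖ ≤ 1 := by simpa using hx
      have hu : ∀ b, ∃ u : C b,
          ‖blockPart p b x - ‖blockPart p b x‖ • u.1‖ ≤ 2 * ε / 3 * ‖blockPart p b x‖ := by
        intro b
        -- Since `0⁻¹ = 0`, a vanishing block part also receives a net point, and its coefficient is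
        -- then zero.
        obtain ⟨u, hu, hxu⟩ := hnet b (‖blockPart p b x‖⁻¹ • blockPart p b x)
          (Submodule.smul_mem _ _ fun i hi => if_neg (by simpa using hi))
          (by
            rw [norm_smul, norm_inv, norm_norm]
            exact inv_mul_le_one)
        refine ⟨⟨u, hu⟩, ?_⟩
        by_cases h0 : ‖blockPart p b x‖ = 0
        · simp [norm_eq_zero.1 h0]
        · have : blockPart p b x - ‖blockPart p b x‖ • u =
              ‖blockPart p b x‖ • (‖blockPart p b x‖⁻¹ • blockPart p b x - u) := by
            rw [smul_sub, smul_inv_smul₀ h0]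
          rw [this, norm_smul, norm_norm, mul_comm]
          gcongr
      choose u hu using hu
      refine ⟨fun j => if j.2 = u j.1 then ‖blockPart p j.1 x‖ else 0, ?_, ?_, ?_⟩
      · calc _ ≤ (Set.range fun b => (⟨b, u b⟩ : Σ b, C b)).ncard := by
              refine Set.ncard_le_ncard (fun j hj => ?_) (Set.toFinite _)
              obtain ⟨b, c⟩ := j
              have : c = u b := by
                by_contra h
                simp [h] at hj
              exact ⟨b, by rw [this]⟩
          _ ≤ s := by
              rw [← Set.image_univ]
              simpa using Set.ncard_image_le (s := Set.univ)
                (f := fun b => (⟨b, u b⟩ : Σ b, C b)) Set.finite_univ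
          _ ≤ t := hst
      · rw [Fintype.sum_sigma]
        simp only [ite_pow, ne_eq, OfNat.ofNat_ne_zero, not_false_eq_true, zero_pow,
          Finset.sum_ite_eq', Finset.mem_univ, if_true]
        rw [sum_norm_blockPart_sq]
        exact pow_le_one₀ (norm_nonneg _) hx1
      · rw [Fintype.sum_sigma]
        simp only [ite_smul, zero_smul, Finset.sum_ite_eq', Finset.mem_univ, if_true]
        set y := ∑ b, ‖blockPart p b x‖ • (u b).1 with hy
        -- Net points of different blocks have disjoint supports, so the error splits blockwise.
        have hyb : ∀ b, blockPart p b (x - y) =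
            blockPart p b x - ‖blockPart p b x‖ • (u b).1 := by
          intro b
          ext i
          have hz : ∀ b, p i ≠ b → (u b).1 i = 0 := fun b hb =>
            (hC b _ (u b).2).1 i (by simpa using hb)
          by_cases hi : p i = b
          · subst hi
            have : y i = ‖blockPart p (p i) x‖ * (u (p i)).1 i := by
              rw [hy, WithLp.ofLp_sum, Finset.sum_apply, Finset.sum_eq_single (p i)]
              · simp
              · intro b _ hb
                simp [hz b hb.symm]
              · simp
            simp [blockPart, this]
          · simp [blockPart, hi, hz b hi]
        have hsq : ‖x - y‖ ^ 2 ≤ (2 * ε / 3) ^ 2 := by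
          calc ‖x - y‖ ^ 2 = ∑ b, ‖blockPart p b (x - y)‖ ^ 2 := (sum_norm_blockPart_sq p _).symm
            _ ≤ ∑ b, (2 * ε / 3) ^ 2 * ‖blockPart p b x‖ ^ 2 := by
                refine Finset.sum_le_sum fun b _ => ?_
                rw [hyb, ← mul_pow]
                exact pow_le_pow_left₀ (norm_nonneg _) (hu b) 2
            _ = (2 * ε / 3) ^ 2 * ‖x‖ ^ 2 := by rw [← Finset.mul_sum, sum_norm_blockPart_sq]
            _ ≤ (2 * ε / 3) ^ 2 :=
                mul_le_of_le_one_right (by positivity) (pow_le_one₀ (norm_nonneg _) hx1)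
        have := (pow_le_pow_iff_left₀ (norm_nonneg _) hε3.le two_ne_zero).1 hsq
        linarith)
  have hreal : (Fintype.card (Σ b, C b) : ℝ) ≤ s * (4 / ε) ^ m := by
    have h4 : (1 : ℝ) ≤ 4 / ε := by
      rw [le_div_iff₀ hε]
      linarith
    have : ∀ b ∈ (Finset.univ : Finset (Fin s)), ((C b).card : ℝ) ≤ (4 / ε) ^ m := fun b _ =>
      calc ((C b).card : ℝ) ≤ _ := hcard b
        _ ≤ (4 / ε) ^ (Finset.univ.filter fun i => p i = b).card := by
          refine pow_le_pow_left₀ (by positivity) ?_ _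
          rw [le_div_iff₀ hε, add_mul]
          have : 2 / (2 * ε / 3) * ε = 3 := by field_simp
          linarith
        _ ≤ (4 / ε) ^ m := pow_le_pow_right₀ h4 (hp b)
    rw [Fintype.card_sigma]
    push_cast
    simpa using Finset.sum_le_card_nsmul _ _ _ this
  calc _ ≤ (((Fintype.card (Σ b, C b) : ℕ) : ℕ∞) : ℝ≥0∞) := ENat.toENNReal_mono hrep
    _ = ENNReal.ofReal (Fintype.card (Σ b, C b)) := by
        rw [ENat.toENNReal_coe, ENNReal.ofReal_natCast]
    _ ≤ _ := ENNReal.ofReal_le_ofReal hreal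

/-- Consecutive blocks of length `m` cover `n` coordinates if `n ≤ m * s`. -/
theorem exists_block_partition {n m s : ℕ} (hm : 0 < m) (h : n ≤ m * s) :
    ∃ p : Fin n → Fin s, ∀ b, (Finset.univ.filter fun i => p i = b).card ≤ m := by
  refine ⟨fun i => ⟨i / m, Nat.div_lt_of_lt_mul (i.2.trans_le h)⟩, fun b => ?_⟩
  calc _ ≤ (Finset.range m).card := by
        -- Within a block the quotient by `m` is fixed, so the remainder determines the index.
        refine Finset.card_le_card_of_injOn (fun i => i % m)
          (fun i _ => by simpa using Nat.mod_lt _ hm) fun i hi j hj hij => ?_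
        simp only [Finset.coe_filter, Finset.mem_univ, true_and, Set.mem_ofPred_eq,
          Fin.ext_iff] at hi hj
        ext
        dsimp only at hij
        rw [← Nat.div_add_mod i m, ← Nat.div_add_mod j m, hi, hj, hij]
    _ = m := Finset.card_range m

/-! ### Numerical estimates and conclusion. -/

/-- From `log (1 / ε) ≤ 1 / ε - 1` the left side is at most `ε * log 4 + 1 - ε`, and `log 4 > 1`. It
cancels the factor `1 / ε` in the bound on `t`. -/
theorem mul_log_four_div_le {ε : ℝ} (hε : 0 < ε) (hε1 : ε ≤ 1) :
    ε * Real.log (4 / ε) ≤ Real.log 4 := by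
  have h4 : Real.log 4 = 2 * Real.log 2 := by
    rw [← Real.log_rpow two_pos]
    norm_num
  have h := Real.log_le_sub_one_of_pos (inv_pos.2 hε)
  rw [Real.log_inv] at h
  rw [Real.log_div (by norm_num) hε.ne']
  have h' := mul_le_mul_of_nonneg_left h hε.le
  rw [mul_sub, mul_inv_cancel₀ hε.ne'] at h'
  nlinarith [Real.log_two_gt_d9]

/-- Splitting `n` coordinates into `t` blocks, the block nets have at most `(4 n / ε) ^ q`
elements in total. -/
theorem mul_pow_ceil_le_rpow {n t : ℕ} {ε q : ℝ} (hn : 1 ≤ n) (hε : 0 < ε) (hε1 : ε ≤ 1)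
    (hq : 3 ≤ q) (ht : 1 ≤ t) (htn : t ≤ n)
    (h : 4 * n / (ε * (Real.log (Real.exp 1 * (3 * Real.exp 1)) + q * Real.log (4 * n)
      - (q + 1) * Real.log ε)) ≤ (t : ℝ)) :
    (t : ℝ) * (4 / ε) ^ ⌈(n / t : ℝ)⌉₊ ≤ (4 * n / ε) ^ q := by
  have hn' : (1 : ℝ) ≤ n := by exact_mod_cast hn
  have ht' : (1 : ℝ) ≤ t := by exact_mod_cast ht
  have htn' : (t : ℝ) ≤ n := by exact_mod_cast htn
  have h4 : Real.log 4 = 2 * Real.log 2 := by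
    rw [← Real.log_rpow two_pos]
    norm_num
  have hl2 := Real.log_two_gt_d9
  have hl2' := Real.log_two_lt_d9
  have hK : Real.log (Real.exp 1 * (3 * Real.exp 1)) = 2 + Real.log 3 := by
    rw [Real.log_mul (by positivity) (by positivity), Real.log_mul (by positivity) (by positivity),
      Real.log_exp]
    ring
  have h3 : Real.log 3 ≤ Real.log 4 := Real.log_le_log (by norm_num) (by norm_num)
  have h30 : 0 ≤ Real.log 3 := Real.log_nonneg (by norm_num)
  have hlε : Real.log ε ≤ 0 := Real.log_nonpos hε.le hε1
  have hln : 0 ≤ Real.log n := Real.log_nonneg hn'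
  have hlt : Real.log t ≤ Real.log n := Real.log_le_log (by linarith) htn'
  have h4n : Real.log (4 * n) = Real.log 4 + Real.log n :=
    Real.log_mul (by norm_num) (by positivity)
  have h4ε : Real.log (4 / ε) = Real.log 4 - Real.log ε := Real.log_div (by norm_num) hε.ne'
  set L := Real.log (4 * n / ε) with hL
  have hLeq : L = Real.log 4 + Real.log n - Real.log ε := by
    rw [hL, Real.log_div (by positivity) hε.ne', h4n]
  set X := Real.log (Real.exp 1 * (3 * Real.exp 1)) + q * Real.log (4 * n)
      - (q + 1) * Real.log ε with hX
  have hXeq : X = 2 + Real.log 3 + q * L - Real.log ε := by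
    rw [hX, hK, hLeq, h4n]
    ring
  have hL4 : Real.log 4 ≤ L := by linarith
  have hqL : 3 * L ≤ q * L := mul_le_mul_of_nonneg_right hq (by linarith)
  have hXpos : 0 < X := by linarith
  have hnt : (n / t : ℝ) ≤ ε * X / 4 := by
    rw [div_le_iff₀ (by positivity)] at h
    rw [div_le_iff₀ (by positivity)]
    linarith
  have hceil : (⌈(n / t : ℝ)⌉₊ : ℝ) ≤ ε * X / 4 + 1 :=
    (Nat.ceil_lt_add_one (by positivity)).le.trans (by linarith)
  have hlog4ε : 0 ≤ Real.log (4 / ε) := by linarith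
  have hεl := mul_log_four_div_le hε hε1
  have hmain : Real.log t + ⌈(n / t : ℝ)⌉₊ * Real.log (4 / ε) ≤ L * q := by
    have h1 : (⌈(n / t : ℝ)⌉₊ : ℝ) * Real.log (4 / ε) ≤ (ε * X / 4 + 1) * Real.log (4 / ε) := by
      gcongr
    -- Here `1.3864` exceeds `log 4`. The left side of `hmain` is then at most `L + 0.3466 * X` with
    -- `X ≤ 2 + (q + 1) * L`, which is below `q * L` because `q ≥ 3` and `L ≥ log 4`.
    have h2 : X / 4 * (ε * Real.log (4 / ε)) ≤ X / 4 * 1.3864 :=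
      mul_le_mul_of_nonneg_left (by linarith) (by linarith)
    nlinarith
  rw [← Real.log_le_log_iff (by positivity) (by positivity), Real.log_mul (by positivity)
    (by positivity), Real.log_pow, Real.log_rpow (by positivity), mul_comm q]
  exact hmain

theorem minCodewords_sparseScheme_le {n t : ℕ} {ε q : ℝ} (hn : 1 ≤ n) (hε : 0 < ε) (hε1 : ε ≤ 1)
    (hq : 3 ≤ q)
    (h : 4 * n / (ε * (Real.log (Real.exp 1 * (3 * Real.exp 1)) + q * Real.log (4 * n)
      - (q + 1) * Real.log ε)) ≤ (t : ℝ)) :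
    ((minCodewords (sparseScheme n t) (Metric.closedBall 0 1) ε : ℕ∞) : ℝ≥0∞) ≤
      ENNReal.ofReal ((4 * n / ε) ^ q) := by
  have hn' : (1 : ℝ) ≤ n := by exact_mod_cast hn
  rcases le_total n t with hnt | htn
  -- With `t ≥ n`, single coordinates serve as blocks, and exponent `1` already suffices.
  · refine (minCodewords_sparseScheme_le_of_blocks (m := 1) hnt hε hε1 id
      fun b => by simp [Finset.filter_eq']).trans (ENNReal.ofReal_le_ofReal ?_)
    calc (n : ℝ) * (4 / ε) ^ 1 = (4 * n / ε) ^ (1 : ℝ) := by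
          rw [Real.rpow_one]
          ring
      _ ≤ (4 * n / ε) ^ q := by
          refine Real.rpow_le_rpow_of_exponent_le ?_ (by linarith)
          rw [le_div_iff₀ hε]
          linarith
  -- The lower bound on `t` is positive, which excludes `t = 0` and the default value of `n / 0`.
  · have ht : 1 ≤ t := by
      have hK : 0 < Real.log (Real.exp 1 * (3 * Real.exp 1)) := by
        refine Real.log_pos ?_
        nlinarith [Real.add_one_le_exp 1]
      have h1 : 0 ≤ q * Real.log (4 * n) :=
        mul_nonneg (by linarith) (Real.log_nonneg (by linarith))
      have h2 : (q + 1) * Real.log ε ≤ 0 :=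
        mul_nonpos_of_nonneg_of_nonpos (by linarith) (Real.log_nonpos hε.le hε1)
      have : (0 : ℝ) < t := lt_of_lt_of_le
        (div_pos (by positivity) (mul_pos hε (by linarith))) h
      exact_mod_cast this
    have ht' : (0 : ℝ) < t := by exact_mod_cast ht
    obtain ⟨p, hp⟩ := exists_block_partition (n := n) (m := ⌈(n / t : ℝ)⌉₊) (s := t)
      (Nat.ceil_pos.2 (by positivity)) (by
        have := Nat.le_ceil (n / t : ℝ)
        rw [div_le_iff₀ ht'] at this
        exact_mod_cast this)
    exact (minCodewords_sparseScheme_le_of_blocks le_rfl hε hε1 p hp).trans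
      (ENNReal.ofReal_le_ofReal (mul_pow_ceil_le_rpow hn hε hε1 hq ht htn h))

theorem proposition1 :
    (∀ (n : ℕ) (ε : ℝ), 1 ≤ n → 0 < ε →
      ENNReal.ofReal (1 / ε ^ n) ≤
        ((minCodewords (clusterScheme n) (Metric.closedBall 0 1) ε : ℕ∞) : ℝ≥0∞)) ∧
    (∃ D K : ℝ, 0 < D ∧ IsSparseCoveringConstant D ∧ K = Real.exp 1 * D ∧
      ∀ (n : ℕ) (ε η q : ℝ) (t : ℕ), 1 ≤ n → 0 < ε → ε ≤ 1 → 0 < η → η < 1 →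
        max 3 (Real.log (4 / ε) / Real.log (Real.log (2 * n / η))) ≤ q →
        4 * n / (ε * (Real.log K + q * Real.log (4 * n) - (q + 1) * Real.log ε)) ≤ (t : ℝ) →
        ((minCodewords (sparseScheme n t) (Metric.closedBall 0 1) ε : ℕ∞) : ℝ≥0∞)
          ≤ ENNReal.ofReal ((4 * n / ε) ^ q)) := by
  refine ⟨fun n ε _ hε => le_minCodewords_clusterScheme n hε, 3 * Real.exp 1,
    Real.exp 1 * (3 * Real.exp 1), by positivity, isSparseCoveringConstant_three_mul_exp, rfl, ?_⟩
  intro n ε η q t hn hε hε1 _ _ hq h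
  exact minCodewords_sparseScheme_le hn hε hε1 ((le_max_left _ _).trans hq) h
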